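/- **Affine forms.** A generalized affine form is $\hat x=\alpha_0^x+\sum_{i\ge 1}\alpha_i^x\varepsilon_i+\beta^x\varepsilon_U$ with real coefficients, $\sum_i|\alpha^x_i|<\infty$ and $\beta^x\ge 0$; $\mathbb A_+$ is the set of these forms, with the $\ell_1$ distance $|\alpha_0^x-\alpha_0^y|+\sum_i|\alpha_i^x-\alpha_i^y|+|\beta^x-\beta^y|$. Its concretization is the interval $\gamma(\hat x)=[\alpha_0^x-r,\alpha_0^x+r]$, $r=\sum_{i\ge1}|\alpha_i^x|+\beta^x$. An environment $\sigma$ maps each variable $v$ of a finite set to a form in $\mathbb A_+$; it has finite support if only finitely many $\varepsilon_i$ occur in it. Its joint concretization $\gamma(\sigma)$ is the set of all tuples $(\alpha^v_0+\sum_i\alpha^v_i t_i+\beta^v u_v)_v$ with $t_i,u_v\in[-1,1]$. The operations are: the sum, coefficientwise; the product by $c\in\mathbb R$, which multiplies every $\alpha_i$ by $c$ and $\beta$ by $|c|$; the widening $\hat z=\hat x\nabla\hat y$, where $\gamma(\hat z)$ is the interval hull of $\gamma(\hat x)\cup\gamma(\hat y)$, $\alpha^z_0$ is its midpoint, $\alpha_i^z$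 ($i\ge1$) is the number of least absolute value between $\alpha^x_i$ and $\alpha^y_i$, and $\beta^z=\sup\gamma(\hat z)-\alpha_0^z-\sum_{i\ge1}|\alpha_i^z|$; the shift $!\sigma$, which replaces $\beta^v\varepsilon_U$ by $\beta^v\varepsilon_{f_v}$ for each variable $v$, with distinct noise symbols $\varepsilon_{f_v}$ that do not occur in $\sigma$. On environments $\nabla$ acts componentwise. **The filter.** Let $n\ge1$, $a_1,\dots,a_n,b_1,\dots,b_{n+1}\in\mathbb R$, $m\le M$, and consider $$x_{k+n+1}=\sum_{i=1}^n a_i x_{k+i}+\sum_{j=1}^{n+1}b_j e_{k+j}\qquad(k\ge0),$$ with inputs in $[m,M]$. The state at the head of the loop after $k$ iterations is $s_k=(x_{k+1},\dots,x_{k+n},e_{k+1},\dots,e_{k+n})$. The abstract semantics $F$ of one iteration of the loop maps an environment for these $2n$ variables to the one obtained by taking $\frac{m+M}2+\frac{M-m}2\varepsilon_f$, $\varepsilon_f$ fresh, as the new input, evaluating the right-hand side above with the abstract operations to get the new output, and dropping the oldest output and the oldest input. **The scheme.** Given an environment $\sigma_0$ of finite support (the entry environment, which describes $x_1,\dots,x_n,e_1,\dots,e_n$),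 an integer $q\ge1$ and a bounded interval $I$, the $(0,q,\nabla)$-iteration scheme starts from $\bot$, then takes $\sigma_0$, and goes on with $\sigma\mapsto\sigma\nabla F^q(!\sigma)$, an iterate being replaced by $\top$ if one of its concretizations is not contained in $I$. **Theorem.** Suppose that all complex roots of $x^n-\sum_{i=0}^{n-1}a_{i+1}x^i$ have modulus strictly less than $1$. Then there is $q\ge1$, depending only on $a_1,\dots,a_n$, such that for all $b_1,\dots,b_{n+1}$, all $m\le M$ and every entry environment $\sigma_0$ of finite support there is an environment $\sigma_\infty$ of finite support, with values in $\mathbb A_+$ (so that all its concretizations are bounded), with the following properties. 1. For every bounded interval $I$ that contains $\gamma(\sigma_\infty(v))$ for all $v$, the $(0,q,\nabla)$-iteration scheme with the interval $I$ never reaches $\top$, and it converges to $\sigma_\infty$ in the $\ell_1$ distance, in each variable. 2. $\sigma_\infty$ is a fixed point of the iteration: $\sigma_\infty\nabla F^q(!\sigma_\infty)=\sigma_\infty$. 3. It over-approximates the filter, at the $q$ copies of the loop head in the $q$-fold unfolded loop: for every run with $s_0\in\gamma(\sigma_0)$ and $e_k\in[m,M]$ for $k>n$, we have $s_{tq}\in\gamma(\sigma_\infty)$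 and $s_{tq+r}\in\gamma(F^r(!\sigma_\infty))$ for all $t\ge0$ and $0\le r<q$. Consequently the environment $\tau=\sigma_\infty\nabla\,!\sigma_\infty\nabla F(!\sigma_\infty)\nabla\cdots\nabla F^{q-1}(!\sigma_\infty)$ satisfies $s_k\in\gamma(\tau)$ for all $k\ge0$, and all outputs lie in bounded intervals: $x_{k+i}\in\gamma(\tau(x_i))$ for all $k\ge0$ and $1\le i\le n$, where $\tau(x_i)$ is the form that $\tau$ assigns to the $i$-th output variable. -/

import Mathlib

open Filter Topology

noncomputable section

namespace AffineFilter

/-- A generalized affine form `center + ∑ i, noise i * ε_i + beta * ε_U` with absolutely summable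
noise coefficients and `0 ≤ beta`, i.e. an element of the cone `𝔸₊` of `𝔸₁`. -/
@[ext]
structure AForm where
  center : ℝ
  noise : ℕ → ℝ
  beta : ℝ
  summable : Summable fun i => |noise i|
  beta_nonneg : 0 ≤ beta

namespace AForm

/-- The semi-norm `‖x‖_L`: the sum of the absolute values of the noise coefficients. -/
def normL (x : AForm) : ℝ := ∑' i, |x.noise i|

/-- Half of the width of the concretization. -/
def dev (x : AForm) : ℝ := x.normL + x.beta

/-- Lower bound of the concretization. -/
def lo (x : AForm) : ℝ := x.center - x.dev

/-- Upper bound of the concretization. -/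
def hi (x : AForm) : ℝ := x.center + x.dev

/-- The concretization of an affine form, a compact interval. -/
def gamma (x : AForm) : Set ℝ := Set.Icc x.lo x.hi

/-- The `ℓ₁` distance of two generalized affine forms. -/
def l1dist (x y : AForm) : ℝ :=
  |x.center - y.center| + ∑' i, |x.noise i - y.noise i| + |x.beta - y.beta|

instance : Zero AForm := ⟨⟨0, fun _ => 0, 0, by simp, le_rfl⟩⟩

/-- The abstract sum. -/
instance : Add AForm :=
  ⟨fun x y =>
    { center := x.center + y.center
      noise := fun i => x.noise i + y.noise i
      beta := x.beta + y.beta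
      summable := (x.summable.add y.summable).of_nonneg_of_le (fun _ => abs_nonneg _)
        (fun _ => abs_add_le _ _)
      beta_nonneg := add_nonneg x.beta_nonneg y.beta_nonneg }⟩

/-- The abstract product with a real constant. The coefficient of `ε_U` is multiplied by `|c|`. -/
instance : SMul ℝ AForm :=
  ⟨fun c x =>
    { center := c * x.center
      noise := fun i => c * x.noise i
      beta := |c| * x.beta
      summable := by simpa only [abs_mul] using x.summable.mul_left |c|
      beta_nonneg := mul_nonneg (abs_nonneg c) x.beta_nonneg }⟩

instance : AddCommMonoid AForm where
  add_assoc x y z := by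
    ext
    · exact add_assoc _ _ _
    · exact add_assoc _ _ _
    · exact add_assoc _ _ _
  zero_add x := by
    ext
    · exact zero_add _
    · exact zero_add _
    · exact zero_add _
  add_zero x := by
    ext
    · exact add_zero _
    · exact add_zero _
    · exact add_zero _
  add_comm x y := by
    ext
    · exact add_comm _ _
    · exact add_comm _ _
    · exact add_comm _ _
  nsmul := nsmulRec

/-- The real number of least absolute value between `u` and `v`. -/
def argmin (u v : ℝ) : ℝ := max (min u v) (min (max u v) 0)

theorem abs_argmin_le_left (u v : ℝ) : |argmin u v| ≤ |u| := by
  unfold argmin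
  grind

theorem abs_argmin_le_right (u v : ℝ) : |argmin u v| ≤ |v| := by
  unfold argmin
  grind

theorem argmin_summable (x y : AForm) : Summable fun i => |argmin (x.noise i) (y.noise i)| :=
  x.summable.of_nonneg_of_le (fun _ => abs_nonneg _) (fun _ => abs_argmin_le_left _ _)

/-- The widening `x ∇ y`: its concretization is the interval hull of the two concretizations, its
noise coefficients are the `argmin`s, and `ε_U` takes the rest. -/
def nabla (x y : AForm) : AForm where
  center := (min x.lo y.lo + max x.hi y.hi) / 2
  noise := fun i => argmin (x.noise i) (y.noise i)
  beta := max x.hi y.hi - (min x.lo y.lo + max x.hi y.hi) / 2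
    - ∑' i, |argmin (x.noise i) (y.noise i)|
  summable := argmin_summable x y
  beta_nonneg := by
    have h1 : ∑' i, |argmin (x.noise i) (y.noise i)| ≤ x.normL :=
      (argmin_summable x y).tsum_le_tsum (fun _ => abs_argmin_le_left _ _) x.summable
    have h2 : x.hi - x.lo = 2 * (x.normL + x.beta) := by simp only [hi, lo, dev]; ring
    have h3 := x.beta_nonneg
    have h4 := le_max_left x.hi y.hi
    have h5 := min_le_left x.lo y.lo
    linarith

/-- The form `c + d * ε_s`. -/
def single (c : ℝ) (s : ℕ) (d : ℝ) : AForm where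
  center := c
  noise := Pi.single s d
  beta := 0
  summable := summable_of_ne_finset_zero (s := {s}) fun i hi => by
    have h : i ≠ s := by simpa using hi
    simp [h]
  beta_nonneg := le_rfl

/-- The form with `beta * ε_U` replaced by `beta * ε_s`. -/
def moveU (x : AForm) (s : ℕ) : AForm where
  center := x.center
  noise := fun i => x.noise i + (Pi.single s x.beta : ℕ → ℝ) i
  beta := 0
  summable := (x + single 0 s x.beta).summable
  beta_nonneg := le_rfl

end AForm

/-- The variables of a filter of order `n` at the head of the loop: the last `n` outputs (`inl`) and
the last `n` inputs (`inr`), both from the oldest to the newest. -/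
abbrev Var (n : ℕ) : Type := Fin n ⊕ Fin n

/-- Abstract environments. -/
abbrev Env (n : ℕ) : Type := Var n → AForm

namespace Env

variable {n : ℕ}

/-- Only finitely many noise symbols occur in the environment. -/
def FiniteSupport (σ : Env n) : Prop := ∃ N, ∀ v, ∀ i, N ≤ i → (σ v).noise i = 0

/-- The first index from which on no noise symbol occurs in the environment (used for environments
of finite support only). -/
def freshIdx (σ : Env n) : ℕ := sInf {N | ∀ v, ∀ i, N ≤ i → (σ v).noise i = 0}

/-- The joint concretization: the noise symbols are shared by the variables, whereas each variable
has a union symbol of its own. -/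
def gamma (σ : Env n) : Set (Var n → ℝ) :=
  {p | ∃ t : ℕ → ℝ, (∀ i, |t i| ≤ 1) ∧ ∃ u : Var n → ℝ, (∀ v, |u v| ≤ 1) ∧
    ∀ v, p v = (σ v).center + ∑' i, (σ v).noise i * t i + (σ v).beta * u v}

/-- The shift operator `!`: the union symbol of each variable is replaced by a fresh noise symbol,
distinct variables getting distinct symbols. -/
def shift (σ : Env n) : Env n :=
  fun v => (σ v).moveU (freshIdx σ + (finSumFinEquiv v : ℕ))

/-- The widening, componentwise. -/
def nabla (σ τ : Env n) : Env n := fun v => (σ v).nabla (τ v)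

end Env

/-- The abstract semantics of one iteration of the body of the loop: read a new input in `[m, M]`
(a fresh noise symbol), compute the new output `∑ a_i x_i + ∑ b_j e_j`, discard the oldest output
and the oldest input. -/
def body {n : ℕ} (a : Fin n → ℝ) (b : Fin (n + 1) → ℝ) (m M : ℝ) (σ : Env n) : Env n :=
  let newInput : AForm := AForm.single ((m + M) / 2) (Env.freshIdx σ) ((M - m) / 2)
  let inputs : Fin (n + 1) → AForm :=
    Fin.snoc (α := fun _ => AForm) (fun j => σ (Sum.inr j)) newInput
  let newOutput : AForm := ∑ i, a i • σ (Sum.inl i) + ∑ j, b j • inputs j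
  let outputs : Fin (n + 1) → AForm :=
    Fin.snoc (α := fun _ => AForm) (fun i => σ (Sum.inl i)) newOutput
  Sum.elim (fun i => outputs i.succ) (fun j => inputs j.succ)

/-- Abstract values: environments with a bottom and a top element added. -/
inductive Lifted (n : ℕ) : Type
  | bot : Lifted n
  | val (σ : Env n) : Lifted n
  | top : Lifted n

namespace Lifted

variable {n : ℕ}

/-- The widening on lifted environments. -/
def nabla : Lifted n → Lifted n → Lifted n
  | bot, y => y
  | top, _ => top
  | val σ, bot => val σ
  | val σ, val τ => val (σ.nabla τ)
  | val _, top => top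

/-- What reaches the head of the loop: from `⊥` (head not reached yet) the entry environment
`σ₀`, and from `σ` the result `F^c (! σ)` of `c` iterations of the body. -/
def cycle (σ₀ : Env n) (F : Env n → Env n) (c : ℕ) : Lifted n → Lifted n
  | bot => val σ₀
  | val σ => val (F^[c] σ.shift)
  | top => top

open Classical in
/-- Replace by `⊤` an environment that leaves the interval `[lo, hi]`. -/
def cut (lo hi : ℝ) : Lifted n → Lifted n
  | bot => bot
  | val σ => if ∀ v, (σ v).gamma ⊆ Set.Icc lo hi then val σ else top
  | top => top

end Lifted

/-- The iterates of the `(0, c, ∇)`-iteration scheme, parametrized by the interval `[lo, hi]`, for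
the loop with entry environment `σ₀` and abstract body `F`: start from `⊥` and iterate
`y ↦ y ∇ F^c (! y)`. -/
def scheme {n : ℕ} (σ₀ : Env n) (F : Env n → Env n) (c : ℕ) (lo hi : ℝ) : ℕ → Lifted n
  | 0 => Lifted.bot
  | k + 1 => ((scheme σ₀ F c lo hi k).nabla ((scheme σ₀ F c lo hi k).cycle σ₀ F c)).cut lo hi

/-- After the initial `⊥` all the values are environments (never `⊤`), and they tend to `σ` in
`ℓ₁` norm, in each variable. -/
def ConvergesTo {n : ℕ} (y : ℕ → Lifted n) (σ : Env n) : Prop :=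
  ∃ s : ℕ → Env n, (∀ k, y (k + 1) = Lifted.val (s k)) ∧
    ∀ v, Tendsto (fun k => AForm.l1dist (s k v) (σ v)) atTop (𝓝 0)

/-- The join `σ ∇ !σ ∇ F (! σ) ∇ ⋯ ∇ F^(c-1) (! σ)` of the environments at the `c` copies of the head
of the loop in the `c`-fold unfolded loop. -/
def copiesJoin {n : ℕ} (F : Env n → Env n) (σ : Env n) : ℕ → Env n
  | 0 => σ
  | r + 1 => (copiesJoin F σ r).nabla (F^[r] σ.shift)

/-- The values of the variables at the head of the loop after `k` iterations. -/
def stateAt (n : ℕ) (x e : ℕ → ℝ) (k : ℕ) : Var n → ℝ :=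
  Sum.elim (fun i => x (k + i)) (fun j => e (k + j))

/-- `x` is the sequence of outputs of the filter for the sequence of inputs `e`, started in a state
of the entry environment `σ₀`, all the inputs read by the loop being between `m` and `M`. -/
def IsRun {n : ℕ} (a : Fin n → ℝ) (b : Fin (n + 1) → ℝ) (m M : ℝ) (σ₀ : Env n)
    (x e : ℕ → ℝ) : Prop :=
  stateAt n x e 0 ∈ σ₀.gamma ∧
    (∀ k, e (k + n) ∈ Set.Icc m M) ∧
    ∀ k, x (k + n) = ∑ i : Fin n, a i * x (k + i) + ∑ j : Fin (n + 1), b j * e (k + j)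

end AffineFilter

end

open AffineFilter

/-!
One iteration of the loop acts on states by the matrix `stepMat a b`, which is block triangular: one
diagonal block is the companion matrix `C` of the recurrence, the other one is the nilpotent shift of
the window of inputs. The eigenvalues of `C` are the roots of the characteristic polynomial, so
Gelfand's formula gives a `q ≥ n` such that the absolute row sums of `C ^ q` are at most `1 / 2`
(`exists_companion_pow_rowSum_le`). This `q` depends on `a` only, and after `q ≥ n` iterations the
inputs of the window have been forgotten.

After a shift no union symbol is left, and the body of the loop acts linearly on the center and on
the coefficients of each noise symbol. Hence the center and the deviation of `F^q (!σ)` have explicit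
expressions (`center_iterate`, `dev_iterate`), continuous in `σ` and bounded through the matrix of
absolute values of `stepMat a b ^ q`. The latter is block triangular with `|C ^ q|` and `0` on the
diagonal, so there is an invariant box (`exists_invariant_box`), and the concretizations of the
iterates `σ ↦ σ ∇ F^q (!σ)` stay bounded. They also increase, while each noise coefficient moves
towards `0` without crossing it and no symbol outside the support of `σ₀` ever survives. Therefore the
iterates converge (`AForm.exists_tendsTo`), and by continuity the limit is a fixed point
(`nabla_iterate_eq_of_tendsTo`). The indices of the fresh symbols are not continuous in `σ`; this is
harmless, because they enter the expressions only through sums over all symbols, and a fresh symbol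
is never one that occurs in `σ` (`col_iterate`).

For the soundness, the order `AForm.Below`, for which widening is an upper bound, implies inclusion
of joint concretizations (`Env.gamma_mono`). It passes to limits, so that `σ₀` is below the limit, and
the shift and the body are sound (`Env.gamma_subset_gamma_shift`, `mem_gamma_body`).
-/

namespace AffineFilter

/-! ### The matrix of the loop -/

section Matrices

variable {R : Type*} [CommRing R] {n : ℕ}

/-- The companion matrix of `X ^ n - ∑ i, a i * X ^ i`: it maps the last `n` outputs to the next
ones when all the inputs vanish. -/
def companion (a : Fin n → R) : Matrix (Fin n) (Fin n) R :=
  fun i j => if (i : ℕ) + 1 < n then if (j : ℕ) = i + 1 then 1 else 0 else a j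

/-- The contribution of the last `n` inputs to the next outputs. -/
def inputBlock (b : Fin (n + 1) → ℝ) : Matrix (Fin n) (Fin n) ℝ :=
  fun i j => if (i : ℕ) + 1 < n then 0 else b j.castSucc

/-- The shift of the window of inputs. -/
def shiftBlock (n : ℕ) : Matrix (Fin n) (Fin n) ℝ :=
  fun i j => if (j : ℕ) = i + 1 then 1 else 0

/-- The matrix of one iteration of the loop, acting on the last outputs and inputs; the input that
is read is accounted for by `inputVec`. -/
def stepMat (a : Fin n → ℝ) (b : Fin (n + 1) → ℝ) : Matrix (Var n) (Var n) ℝ :=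
  Matrix.fromBlocks (companion a) (inputBlock b) 0 (shiftBlock n)

/-- The contribution of the input that is read to the state after one iteration. -/
def inputVec (b : Fin (n + 1) → ℝ) : Var n → ℝ :=
  Sum.elim (fun i => if (i : ℕ) + 1 < n then 0 else b (Fin.last n))
    (fun j => if (j : ℕ) + 1 < n then 0 else 1)

theorem companion_mulVec (a : Fin n → R) (x : Fin n → R) (i : Fin n) :
    (companion a).mulVec x i = if h : (i : ℕ) + 1 < n then x ⟨i + 1, h⟩ else ∑ j, a j * x j := by
  simp only [Matrix.mulVec, dotProduct, companion]
  split_ifs with h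
  · rw [Finset.sum_eq_single ⟨i + 1, h⟩]
    · rw [if_pos rfl, one_mul]
    · intro j _ hj
      rw [if_neg, zero_mul]
      exact fun h' => hj (Fin.ext h')
    · simp
  · rfl

theorem inputBlock_mulVec (b : Fin (n + 1) → ℝ) (e : Fin n → ℝ) (i : Fin n) :
    (inputBlock b).mulVec e i = if (i : ℕ) + 1 < n then 0 else ∑ j, b j.castSucc * e j := by
  simp only [Matrix.mulVec, dotProduct, inputBlock]
  split_ifs with h
  · simp
  · rfl

theorem shiftBlock_mulVec (e : Fin n → ℝ) (i : Fin n) :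
    (shiftBlock n).mulVec e i = if h : (i : ℕ) + 1 < n then e ⟨i + 1, h⟩ else 0 := by
  simp only [Matrix.mulVec, dotProduct, shiftBlock]
  split_ifs with h
  · rw [Finset.sum_eq_single ⟨i + 1, h⟩]
    · rw [if_pos rfl, one_mul]
    · intro j _ hj
      rw [if_neg, zero_mul]
      exact fun h' => hj (Fin.ext h')
    · simp
  · refine Finset.sum_eq_zero fun j _ => ?_
    rw [if_neg (by omega), zero_mul]

theorem stepMat_mulVec_inl (a : Fin n → ℝ) (b : Fin (n + 1) → ℝ) (p : Var n → ℝ) (i : Fin n) :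
    (stepMat a b).mulVec p (Sum.inl i) = if h : (i : ℕ) + 1 < n then p (Sum.inl ⟨i + 1, h⟩)
      else ∑ j, a j * p (Sum.inl j) + ∑ j : Fin n, b j.castSucc * p (Sum.inr j) := by
  rw [stepMat, Matrix.fromBlocks_mulVec, Sum.elim_inl, Pi.add_apply, companion_mulVec,
    inputBlock_mulVec]
  split_ifs <;> simp

theorem stepMat_mulVec_inr (a : Fin n → ℝ) (b : Fin (n + 1) → ℝ) (p : Var n → ℝ) (i : Fin n) :
    (stepMat a b).mulVec p (Sum.inr i)
      = if h : (i : ℕ) + 1 < n then p (Sum.inr ⟨i + 1, h⟩) else 0 := by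
  rw [stepMat, Matrix.fromBlocks_mulVec, Sum.elim_inr, Pi.add_apply, shiftBlock_mulVec]
  simp

theorem stepMat_pow_inl_inl (a : Fin n → ℝ) (b : Fin (n + 1) → ℝ) (r : ℕ) (i j : Fin n) :
    (stepMat a b ^ r) (Sum.inl i) (Sum.inl j) = (companion a ^ r) i j := by
  suffices h : ∃ X Y, stepMat a b ^ r = Matrix.fromBlocks (companion a ^ r) X 0 Y by
    obtain ⟨X, Y, h⟩ := h
    rw [h, Matrix.fromBlocks_apply₁₁]
  induction r with
  | zero => exact ⟨0, 1, by rw [pow_zero, pow_zero, Matrix.fromBlocks_one]⟩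
  | succ r ih =>
    obtain ⟨X, Y, h⟩ := ih
    rw [pow_succ, h, stepMat, Matrix.fromBlocks_multiply]
    exact ⟨_, _, by rw [mul_zero, add_zero, zero_mul, mul_zero, add_zero, ← pow_succ]⟩

/-- After `n` iterations all the inputs in the window have been read inside the loop. -/
theorem stepMat_pow_inr (a : Fin n → ℝ) (b : Fin (n + 1) → ℝ) {r : ℕ} (hr : n ≤ r) (j : Fin n)
    (w : Var n) : (stepMat a b ^ r) (Sum.inr j) w = 0 := by
  suffices h : ∀ (r : ℕ) (p : Var n → ℝ) (j : Fin n), n ≤ j + r →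
      (stepMat a b ^ r).mulVec p (Sum.inr j) = 0 by
    simpa using h r (Pi.single w 1) j (by omega)
  intro r
  induction r with
  | zero => intro p j hj; omega
  | succ r ih =>
    intro p j hj
    rw [pow_succ', ← Matrix.mulVec_mulVec, stepMat_mulVec_inr]
    split_ifs with h
    · exact ih p _ (by simp only; omega)
    · rfl

theorem abs_mulVec_le {ι : Type*} [Fintype ι] (P : Matrix ι ι ℝ) (p : ι → ℝ)
    (v : ι) :
    |P.mulVec p v| ≤ ∑ w, |P v w| * |p w| := by
  simp only [Matrix.mulVec, dotProduct, ← abs_mul]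
  exact Finset.abs_sum_le_sum_abs _ _

theorem tendsto_mulVec {ι : Type*} [Fintype ι] (P : Matrix ι ι ℝ) {p : ℕ → ι → ℝ}
    {p' : ι → ℝ}
    (hp : ∀ w, Tendsto (fun k => p k w) atTop (𝓝 (p' w))) (v : ι) :
    Tendsto (fun k => P.mulVec (p k) v) atTop (𝓝 (P.mulVec p' v)) := by
  simp only [Matrix.mulVec, dotProduct]
  exact tendsto_finsetSum _ fun w _ => (hp w).const_mul _

/-! ### Powers of a stable companion matrix -/

/-- An eigenvector of the companion matrix is a multiple of `(1, z, …, z ^ (n - 1))`, and the last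
row says that `z` is a root. -/
theorem root_of_mem_spectrum_companion {K : Type*} [Field K] (hn : 1 ≤ n) (a : Fin n → K) {z : K}
    (hz : z ∈ spectrum K (companion a)) : z ^ n - ∑ i : Fin n, a i * z ^ (i : ℕ) = 0 := by
  rw [← Matrix.spectrum_toLin', ← Module.End.hasEigenvalue_iff_mem_spectrum] at hz
  obtain ⟨v, hv⟩ := hz.exists_hasEigenvector
  have hv0 := hv.2
  have h : ∀ i, (companion a).mulVec v i = z * v i := fun i => by
    have := congrFun hv.apply_eq_smul i
    simpa using this
  have hgeom : ∀ k (hk : k < n), v ⟨k, hk⟩ = z ^ k * v ⟨0, hn⟩ := by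
    intro k
    induction k with
    | zero => intro hk; simp
    | succ k ih =>
      intro hk
      have h1 := h ⟨k, by omega⟩
      rw [companion_mulVec, dif_pos (by exact hk), ih] at h1
      rw [h1]; ring
  have h0 : v ⟨0, hn⟩ ≠ 0 := fun h0 => hv0 (funext fun i => by
    rw [hgeom i i.2, h0, mul_zero, Pi.zero_apply])
  have hlast := h ⟨n - 1, by omega⟩
  rw [companion_mulVec, dif_neg (by simp only; omega), hgeom (n - 1) (by omega), ← mul_assoc,
    ← pow_succ', Nat.sub_add_cancel hn] at hlast
  have hsum : ∑ j, a j * v j = (∑ j, a j * z ^ (j : ℕ)) * v ⟨0, hn⟩ := by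
    rw [Finset.sum_mul]
    exact Finset.sum_congr rfl fun j _ => by rw [hgeom j j.2]; ring
  rw [hsum] at hlast
  rw [sub_eq_zero]
  exact (mul_right_cancel₀ h0 hlast).symm

open scoped NNReal ENNReal in
/-- In a complex Banach algebra, an element whose spectrum lies in the open unit disc has arbitrarily
late powers of small norm. This follows from Gelfand's formula. -/
theorem exists_norm_pow_lt {A : Type*} [NormedRing A] [NormedAlgebra ℂ A] [CompleteSpace A]
    [Nontrivial A] (T : A) (hT : ∀ z ∈ spectrum ℂ T, ‖z‖ < 1) (N : ℕ) {ε : ℝ} (hε : 0 < ε) :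
    ∃ q ≥ N, ‖T ^ q‖ < ε := by
  have h1 : spectralRadius ℂ T < (1 : ℝ≥0) :=
    spectrum.spectralRadius_lt_of_forall_lt T fun z hz => by exact_mod_cast hT z hz
  obtain ⟨r, hr1, hr2⟩ := ENNReal.lt_iff_exists_nnreal_btwn.1 h1
  have hr : r < 1 := by exact_mod_cast hr2
  have h2 := (spectrum.pow_nnnorm_pow_one_div_tendsto_nhds_spectralRadius T).eventually_lt_const hr1
  have h3 : ∀ᶠ q : ℕ in atTop, (r : ℝ) ^ q < ε :=
    (tendsto_pow_atTop_nhds_zero_of_lt_one r.2 (by exact_mod_cast hr)).eventually_lt_const hε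
  obtain ⟨q, hq, hq3, hqN⟩ := (h2.and (h3.and (eventually_ge_atTop (max N 1)))).exists
  have hq0 : q ≠ 0 := by have := le_max_right N 1; omega
  refine ⟨q, (le_max_left _ _).trans hqN, lt_of_le_of_lt ?_ hq3⟩
  have h4 : ((‖T ^ q‖₊ : ℝ≥0∞) ^ (1 / q : ℝ)) ^ (q : ℝ) ≤ (r : ℝ≥0∞) ^ (q : ℝ) :=
    ENNReal.rpow_le_rpow hq.le (by positivity)
  rw [← ENNReal.rpow_mul, one_div, inv_mul_cancel₀ (by exact_mod_cast hq0), ENNReal.rpow_one,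
    ENNReal.rpow_natCast] at h4
  exact_mod_cast h4

attribute [local instance] Matrix.linftyOpNormedRing Matrix.linftyOpNormedAlgebra

/-- If the roots of the characteristic polynomial have modulus less than `1`, then some power
`q ≥ n` of the companion matrix is a contraction of factor `1 / 2` for the sup norm. -/
theorem exists_companion_pow_rowSum_le (hn : 1 ≤ n) (a : Fin n → ℝ)
    (hstable : ∀ z : ℂ, z ^ n - ∑ i : Fin n, (a i : ℂ) * z ^ (i : ℕ) = 0 → ‖z‖ < 1) :
    ∃ q ≥ n, ∀ i, ∑ j, |(companion a ^ q) i j| ≤ 1 / 2 := by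
  have : Nonempty (Fin n) := ⟨⟨0, hn⟩⟩
  have : CompleteSpace (Matrix (Fin n) (Fin n) ℂ) := FiniteDimensional.complete ℂ _
  obtain ⟨q, hq, hlt⟩ := exists_norm_pow_lt (companion fun i => (a i : ℂ))
    (fun z hz => hstable z (root_of_mem_spectrum_companion hn _ hz)) n (ε := 1 / 2) (by norm_num)
  refine ⟨q, hq, fun i => le_trans ?_ hlt.le⟩
  have hmap : (companion fun i => (a i : ℂ)) = (algebraMap ℝ ℂ).mapMatrix (companion a) := by
    ext i j
    simp only [companion, RingHom.mapMatrix_apply, Matrix.map_apply]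
    split_ifs <;> simp
  rw [hmap, ← map_pow, Matrix.linfty_opNorm_def]
  have h := Finset.le_sup (f := fun i => ∑ j, ‖(algebraMap ℝ ℂ).mapMatrix (companion a ^ q) i j‖₊)
    (Finset.mem_univ i)
  refine le_trans (le_of_eq ?_) (NNReal.coe_le_coe.2 h)
  push_cast
  refine Finset.sum_congr rfl fun j _ => ?_
  simp

end Matrices

/-! ### Affine forms -/

namespace AForm

/-- The center, as an additive map. -/
def centerHom : AForm →+ ℝ where
  toFun := center
  map_zero' := rfl
  map_add' _ _ := rfl

/-- The coefficient of a noise symbol, as an additive map. -/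
def noiseHom (i : ℕ) : AForm →+ ℝ where
  toFun x := x.noise i
  map_zero' := rfl
  map_add' _ _ := rfl

/-- The coefficient of the union symbol, as an additive map. -/
def betaHom : AForm →+ ℝ where
  toFun := beta
  map_zero' := rfl
  map_add' _ _ := rfl

theorem ext_of_lo_hi {x y : AForm} (hlo : x.lo = y.lo) (hhi : x.hi = y.hi)
    (hnoise : x.noise = y.noise) : x = y := by
  have hL : x.normL = y.normL := by rw [normL, normL, hnoise]
  simp only [lo, hi, dev] at hlo hhi
  ext i
  · linarith
  · rw [hnoise]
  · linarith

theorem lo_nabla (x y : AForm) : (x.nabla y).lo = min x.lo y.lo := by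
  simp only [lo, dev, nabla, normL]
  ring

theorem hi_nabla (x y : AForm) : (x.nabla y).hi = max x.hi y.hi := by
  simp only [hi, dev, nabla, normL]
  ring

/-- The order for which widening is an upper bound: the concretization of `x` is contained in that
of `y`, and each noise coefficient of `y` lies between `0` and that of `x`. -/
structure Below (x y : AForm) : Prop where
  lo_le : y.lo ≤ x.lo
  hi_le : x.hi ≤ y.hi
  noise_le : ∀ i, |x.noise i - y.noise i| + |y.noise i| ≤ |x.noise i|

theorem Below.refl (x : AForm) : x.Below x := ⟨le_rfl, le_rfl, by simp⟩

theorem Below.trans {x y z : AForm} (h1 : x.Below y) (h2 : y.Below z) : x.Below z where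
  lo_le := h2.lo_le.trans h1.lo_le
  hi_le := h1.hi_le.trans h2.hi_le
  noise_le i := by
    have := h1.noise_le i
    have := h2.noise_le i
    have := abs_sub_le (x.noise i) (y.noise i) (z.noise i)
    linarith

theorem argmin_left (u v : ℝ) : |u - argmin u v| + |argmin u v| ≤ |u| := by
  unfold argmin
  grind

theorem argmin_right (u v : ℝ) : |v - argmin u v| + |argmin u v| ≤ |v| := by
  unfold argmin
  grind

theorem below_nabla_left (x y : AForm) : x.Below (x.nabla y) where
  lo_le := by rw [lo_nabla]; exact min_le_left _ _
  hi_le := by rw [hi_nabla]; exact le_max_left _ _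
  noise_le _ := argmin_left _ _

theorem below_nabla_right (x y : AForm) : y.Below (x.nabla y) where
  lo_le := by rw [lo_nabla]; exact min_le_right _ _
  hi_le := by rw [hi_nabla]; exact le_max_right _ _
  noise_le _ := argmin_right _ _

theorem summable_noise_mul (x : AForm) {t : ℕ → ℝ} (ht : ∀ i, |t i| ≤ 1) :
    Summable fun i => x.noise i * t i := by
  refine Summable.of_norm_bounded x.summable fun i => ?_
  rw [Real.norm_eq_abs, abs_mul]
  exact mul_le_of_le_one_right (abs_nonneg _) (ht i)

theorem abs_tsum_noise_mul_le (x : AForm) {t : ℕ → ℝ} (ht : ∀ i, |t i| ≤ 1) :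
    |∑' i, x.noise i * t i| ≤ x.normL := by
  rw [← Real.norm_eq_abs]
  refine tsum_of_norm_bounded x.summable.hasSum fun i => ?_
  rw [Real.norm_eq_abs, abs_mul]
  exact mul_le_of_le_one_right (abs_nonneg _) (ht i)

/-- Going up in the order, the noise symbols can keep their values: the union symbol makes up for
the difference. -/
theorem Below.exists_union {x y : AForm} (h : x.Below y) {t : ℕ → ℝ} (ht : ∀ i, |t i| ≤ 1)
    {u : ℝ} (hu : |u| ≤ 1) : ∃ u', |u'| ≤ 1 ∧
      x.center + ∑' i, x.noise i * t i + x.beta * u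
        = y.center + ∑' i, y.noise i * t i + y.beta * u' := by
  set D := x.center + ∑' i, x.noise i * t i + x.beta * u - y.center - ∑' i, y.noise i * t i
    with hD
  have hsum : |∑' i, x.noise i * t i - ∑' i, y.noise i * t i| ≤ x.normL - y.normL := by
    rw [← (x.summable_noise_mul ht).tsum_sub (y.summable_noise_mul ht), normL, normL,
      ← x.summable.tsum_sub y.summable, ← Real.norm_eq_abs]
    refine tsum_of_norm_bounded (x.summable.sub y.summable).hasSum fun i => ?_
    rw [Real.norm_eq_abs, ← sub_mul, abs_mul]
    have := mul_le_of_le_one_right (abs_nonneg (x.noise i - y.noise i)) (ht i)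
    have := h.noise_le i
    linarith
  have hbu : |x.beta * u| ≤ x.beta := by
    rw [abs_mul, abs_of_nonneg x.beta_nonneg]
    exact mul_le_of_le_one_right x.beta_nonneg hu
  have hDle : |D| ≤ y.beta := by
    have h1 := h.lo_le
    have h2 := h.hi_le
    simp only [lo, hi, dev] at h1 h2
    rw [abs_le] at hsum hbu ⊢
    constructor <;> linarith [hsum.1, hsum.2, hbu.1, hbu.2]
  rcases eq_or_ne y.beta 0 with h0 | h0
  · refine ⟨0, by simp, ?_⟩
    rw [h0, abs_nonpos_iff] at hDle
    linarith
  · refine ⟨D / y.beta, ?_, ?_⟩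
    · rw [abs_div, abs_of_nonneg y.beta_nonneg]
      exact div_le_one_of_le₀ hDle y.beta_nonneg
    · rw [mul_div_cancel₀ _ h0]
      linarith

end AForm

/-! ### Environments and the body of the loop -/

namespace Env

variable {n : ℕ}

/-- The coefficients of a noise symbol in the variables of an environment. -/
def col (σ : Env n) (i : ℕ) : Var n → ℝ := fun v => (σ v).noise i

theorem gamma_mono {σ τ : Env n} (h : ∀ v, (σ v).Below (τ v)) : σ.gamma ⊆ τ.gamma := by
  rintro p ⟨t, ht, u, hu, hp⟩
  choose u' hu' heq using fun v => (h v).exists_union ht (hu v)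
  exact ⟨t, ht, u', hu', fun v => (hp v).trans (heq v)⟩

theorem mem_gamma_apply {σ : Env n} {p : Var n → ℝ} (hp : p ∈ σ.gamma) (v : Var n) :
    p v ∈ (σ v).gamma := by
  obtain ⟨t, ht, u, hu, h⟩ := hp
  have h1 := abs_le.1 ((σ v).abs_tsum_noise_mul_le ht)
  have h2 : |(σ v).beta * u v| ≤ (σ v).beta := by
    rw [abs_mul, abs_of_nonneg (σ v).beta_nonneg]
    exact mul_le_of_le_one_right (σ v).beta_nonneg (hu v)
  have h3 := abs_le.1 h2
  rw [AForm.gamma, Set.mem_Icc, AForm.lo, AForm.hi, AForm.dev, h v]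
  constructor <;> linarith [h1.1, h1.2, h3.1, h3.2]

theorem FiniteSupport.col_eq_zero {σ : Env n} (hσ : σ.FiniteSupport) {i : ℕ}
    (hi : freshIdx σ ≤ i) : σ.col i = 0 := by
  have h : freshIdx σ ∈ {N | ∀ v, ∀ i, N ≤ i → (σ v).noise i = 0} := Nat.sInf_mem hσ
  exact funext fun v => h v i hi

theorem freshIdx_le {σ : Env n} {N : ℕ} (h : ∀ i, N ≤ i → σ.col i = 0) : freshIdx σ ≤ N :=
  Nat.sInf_le fun v i hi => congrFun (h i hi) v

theorem col_shift (σ : Env n) (i : ℕ) (v : Var n) :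
    σ.shift.col i v = σ.col i v + if i = freshIdx σ + finSumFinEquiv v then (σ v).beta else 0 := by
  simp only [col, shift, AForm.moveU, Pi.single_apply]

theorem col_shift_of_lt (σ : Env n) {i : ℕ} (hi : i < freshIdx σ) : σ.shift.col i = σ.col i := by
  ext v
  rw [col_shift, if_neg (by omega), add_zero]

theorem FiniteSupport.shift {σ : Env n} (hσ : σ.FiniteSupport) : σ.shift.FiniteSupport := by
  refine ⟨freshIdx σ + (n + n), fun v i hi => ?_⟩
  have h := σ.col_shift i v
  have hlt := (finSumFinEquiv v).2
  rw [hσ.col_eq_zero (by omega), if_neg (by omega)] at h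
  simpa [col] using h

theorem freshIdx_le_shift {σ : Env n} (hσ : σ.FiniteSupport) :
    freshIdx σ ≤ freshIdx σ.shift := by
  refine freshIdx_le fun i hi => ?_
  rcases lt_or_ge i (freshIdx σ) with h | h
  · rw [← col_shift_of_lt σ h]
    exact hσ.shift.col_eq_zero hi
  · exact hσ.col_eq_zero h

/-- Under a shift, the fresh symbols add one term for each variable to a sum over the columns. In
this form the statement does not depend on which symbols are fresh. -/
theorem tsum_col_shift {σ : Env n} (hσ : σ.FiniteSupport) {φ : (Var n → ℝ) → ℝ} (hφ : φ 0 = 0) :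
    ∑' i, φ (σ.shift.col i) = ∑' i, φ (σ.col i) + ∑ w, φ (Pi.single w (σ w).beta) := by
  have hpt : ∀ i, φ (σ.shift.col i) = φ (σ.col i)
      + ∑ w, if i = freshIdx σ + finSumFinEquiv w then φ (Pi.single w (σ w).beta) else 0 := by
    intro i
    rcases lt_or_ge i (freshIdx σ) with h | h
    · rw [col_shift_of_lt σ h, Finset.sum_eq_zero, add_zero]
      exact fun w _ => if_neg (by omega)
    · rw [hσ.col_eq_zero h, hφ, zero_add]
      by_cases hw : ∃ w : Var n, i = freshIdx σ + finSumFinEquiv w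
      · obtain ⟨w, hw⟩ := hw
        have hne : ∀ w', w' ≠ w → i ≠ freshIdx σ + (finSumFinEquiv w' : ℕ) := fun w' hw' h' =>
          hw' (finSumFinEquiv.injective (Fin.ext (by omega)))
        rw [Finset.sum_eq_single w (fun w' _ hw' => if_neg (hne w' hw')) (by simp), if_pos hw]
        congr 1
        ext v
        rw [col_shift, hσ.col_eq_zero h, Pi.zero_apply, zero_add]
        rcases eq_or_ne v w with rfl | hv
        · rw [if_pos hw, Pi.single_eq_same]
        · rw [if_neg (hne v hv), Pi.single_eq_of_ne hv]
      · push Not at hw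
        have h0 : σ.shift.col i = 0 := by
          ext v
          rw [col_shift, hσ.col_eq_zero h, if_neg (hw v), add_zero]
        rw [h0, hφ, Finset.sum_eq_zero]
        exact fun w _ => if_neg (hw w)
  have hs1 : Summable fun i => φ (σ.col i) :=
    summable_of_ne_finset_zero (s := Finset.range (freshIdx σ)) fun i hi => by
      rw [hσ.col_eq_zero (by simpa using hi), hφ]
  have hs2 : ∀ w : Var n, Summable fun i => if i = freshIdx σ + finSumFinEquiv w then
      φ (Pi.single w (σ w).beta) else 0 := fun w =>
    summable_of_ne_finset_zero (s := {freshIdx σ + (finSumFinEquiv w : ℕ)}) fun i hi =>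
      if_neg (by simpa using hi)
  simp_rw [hpt]
  rw [hs1.tsum_add (summable_sum fun w _ => hs2 w), Summable.tsum_finsetSum fun w _ => hs2 w]
  simp

/-- Shifting is sound: the fresh symbols take the values of the union symbols. -/
theorem gamma_subset_gamma_shift {σ : Env n} (hσ : σ.FiniteSupport) :
    σ.gamma ⊆ σ.shift.gamma := by
  rintro p ⟨t, ht, u, hu, hp⟩
  let t' : ℕ → ℝ := fun i => if i < freshIdx σ then t i else
    if h : i - freshIdx σ < n + n then u (finSumFinEquiv.symm ⟨i - freshIdx σ, h⟩) else 0
  have ht'v : ∀ v, t' (freshIdx σ + finSumFinEquiv v) = u v := by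
    intro v
    simp [t']
  refine ⟨t', fun i => ?_, u, hu, fun v => ?_⟩
  · simp only [t']
    split_ifs
    · exact ht i
    · exact hu _
    · simp
  · have h : ∀ i, (σ.shift v).noise i * t' i = (σ v).noise i * t i
        + if i = freshIdx σ + finSumFinEquiv v then (σ v).beta * u v else 0 := by
      intro i
      have h1 : (σ.shift v).noise i = _ := σ.col_shift i v
      rw [h1]
      rcases lt_or_ge i (freshIdx σ) with hi | hi
      · rw [if_neg (by omega), if_neg (by omega), add_zero, add_zero]
        simp [t', hi, col]
      · have h2 : (σ v).noise i = 0 := congrFun (hσ.col_eq_zero hi) v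
        rw [hσ.col_eq_zero hi, Pi.zero_apply, zero_add, h2, zero_mul, zero_add]
        split_ifs with hv
        · rw [hv, ht'v]
        · rw [zero_mul]
    simp_rw [h]
    rw [((σ v).summable_noise_mul ht).tsum_add, tsum_ite_eq]
    · change _ = (σ v).center + _ + 0 * _
      rw [hp v]
      ring
    · exact summable_of_ne_finset_zero (s := {freshIdx σ + (finSumFinEquiv v : ℕ)}) fun i hi =>
        if_neg (by simpa using hi)

end Env

section Body

variable {n : ℕ} (a : Fin n → ℝ) (b : Fin (n + 1) → ℝ) (m M : ℝ)

theorem snoc_succ {α : Type*} (x : Fin n → α) (y : α) (i : Fin n) :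
    (Fin.snoc (α := fun _ => α) x y : Fin (n + 1) → α) i.succ
      = if h : (i : ℕ) + 1 < n then x ⟨i + 1, h⟩ else y := by
  simp only [Fin.snoc, Fin.val_succ]
  split_ifs <;> rfl

/-- A linear functional of the forms is transformed by the body of the loop as the state is by an
iteration of the loop. -/
theorem map_body (π : AForm →+ ℝ) (hπ : ∀ (c : ℝ) (x : AForm), π (c • x) = c * π x) (σ : Env n)
    (v : Var n) : π (body a b m M σ v) = ((stepMat a b).mulVec fun w => π (σ w)) v
      + π (AForm.single ((m + M) / 2) (Env.freshIdx σ) ((M - m) / 2)) * inputVec b v := by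
  rcases v with i | i
  · simp only [body, Sum.elim_inl, snoc_succ, stepMat_mulVec_inl, inputVec]
    split_ifs with h
    · simp
    · simp only [Fin.sum_univ_castSucc, Fin.snoc_castSucc, Fin.snoc_last, map_add, map_sum, hπ]
      ring
  · simp only [body, Sum.elim_inr, snoc_succ, stepMat_mulVec_inr, inputVec]
    split_ifs with h <;> simp

theorem center_body (σ : Env n) : (fun v => (body a b m M σ v).center)
    = (stepMat a b).mulVec (fun v => (σ v).center) + ((m + M) / 2) • inputVec b :=
  funext fun v => map_body a b m M AForm.centerHom (fun _ _ => rfl) σ v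

theorem col_body (σ : Env n) (i : ℕ) : Env.col (body a b m M σ) i
    = (stepMat a b).mulVec (σ.col i)
      + (if i = Env.freshIdx σ then (M - m) / 2 else 0) • inputVec b := by
  ext v
  refine (map_body a b m M (AForm.noiseHom i) (fun _ _ => rfl) σ v).trans ?_
  simp only [AForm.noiseHom, AddMonoidHom.coe_mk, ZeroHom.coe_mk, AForm.single, Pi.single_apply]
  rfl

theorem beta_body {σ : Env n} (hσ : ∀ v, (σ v).beta = 0) (v : Var n) :
    (body a b m M σ v).beta = 0 := by
  have hsmul : ∀ (c : ℝ) (x : AForm), AForm.betaHom (c • x) = |c| * AForm.betaHom x :=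
    fun _ _ => rfl
  have hσ' : ∀ v, AForm.betaHom (σ v) = 0 := hσ
  have hs : ∀ c s d, AForm.betaHom (AForm.single c s d) = 0 := fun _ _ _ => rfl
  change AForm.betaHom _ = 0
  rcases v with i | i
  · simp only [body, Sum.elim_inl, snoc_succ]
    split_ifs with h
    · exact hσ' _
    · simp only [Fin.sum_univ_castSucc, Fin.snoc_castSucc, Fin.snoc_last, map_add, map_sum, hsmul,
        hσ', hs]
      simp
  · simp only [body, Sum.elim_inr, snoc_succ]
    split_ifs with h
    · exact hσ' _
    · exact hs _ _ _

theorem finiteSupport_body {σ : Env n} (hσ : σ.FiniteSupport) :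
    (body a b m M σ).FiniteSupport := by
  refine ⟨Env.freshIdx σ + 1, fun v i hi => ?_⟩
  have h := congrFun (col_body a b m M σ i) v
  rw [hσ.col_eq_zero (by omega), if_neg (by omega), Matrix.mulVec_zero, zero_smul, add_zero] at h
  exact h

/-- If the input is not constant, its symbol occurs after the iteration, in the newest input: it
will not be used again for the next input. -/
theorem freshIdx_lt_body (hn : 1 ≤ n) (hmM : m ≠ M) {σ : Env n} (hσ : σ.FiniteSupport) :
    Env.freshIdx σ < Env.freshIdx (body a b m M σ) := by
  by_contra! hle
  have h := col_body a b m M σ (Env.freshIdx σ)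
  rw [(finiteSupport_body a b m M hσ).col_eq_zero hle, hσ.col_eq_zero le_rfl, if_pos rfl,
    Matrix.mulVec_zero, zero_add] at h
  have h2 := congrFun h (Sum.inr ⟨n - 1, by omega⟩)
  simp only [Pi.zero_apply, Pi.smul_apply, inputVec, Sum.elim_inr, smul_eq_mul] at h2
  rw [if_neg (by omega), mul_one] at h2
  exact hmM (by linarith)

theorem tsum_col_body {σ : Env n} (hσ : σ.FiniteSupport) {φ : (Var n → ℝ) → ℝ} (hφ : φ 0 = 0) :
    ∑' i, φ (Env.col (body a b m M σ) i)
      = ∑' i, φ ((stepMat a b).mulVec (σ.col i)) + φ (((M - m) / 2) • inputVec b) := by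
  have hpt : ∀ i, φ (Env.col (body a b m M σ) i) = φ ((stepMat a b).mulVec (σ.col i))
      + if i = Env.freshIdx σ then φ (((M - m) / 2) • inputVec b) else 0 := by
    intro i
    rw [col_body]
    split_ifs with h
    · rw [hσ.col_eq_zero h.ge, Matrix.mulVec_zero, hφ]
      simp
    · simp
  simp_rw [hpt]
  rw [Summable.tsum_add, tsum_ite_eq]
  · refine summable_of_ne_finset_zero (s := Finset.range (Env.freshIdx σ)) fun i hi => ?_
    rw [hσ.col_eq_zero (by simpa using hi), Matrix.mulVec_zero, hφ]
  · exact summable_of_ne_finset_zero (s := {Env.freshIdx σ}) fun i hi =>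
      if_neg (by simpa using hi)

/-- One iteration of the loop is sound, provided that the union symbols do not occur: they would
not be shared between the old values and the new output. -/
theorem mem_gamma_body {σ : Env n} (hσ : σ.FiniteSupport) (hβ : ∀ v, (σ v).beta = 0)
    {p : Var n → ℝ} (hp : p ∈ σ.gamma) {e : ℝ} (he : e ∈ Set.Icc m M) :
    (stepMat a b).mulVec p + e • inputVec b ∈ Env.gamma (body a b m M σ) := by
  obtain ⟨t, ht, u, hu, hp⟩ := hp
  obtain ⟨s, hs, hes⟩ : ∃ s : ℝ, |s| ≤ 1 ∧ e = (m + M) / 2 + (M - m) / 2 * s := by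
    have hd : |e - (m + M) / 2| ≤ (M - m) / 2 := by
      rw [abs_le]
      constructor <;> linarith [he.1, he.2]
    rcases eq_or_ne ((M - m) / 2) 0 with h0 | h0
    · refine ⟨0, by simp, ?_⟩
      rw [h0, abs_nonpos_iff] at hd
      linarith
    · have hpos : 0 ≤ (M - m) / 2 := (abs_nonneg _).trans hd
      refine ⟨(e - (m + M) / 2) / ((M - m) / 2), ?_, ?_⟩
      · rw [abs_div, abs_of_nonneg hpos]
        exact div_le_one_of_le₀ hd hpos
      · rw [mul_div_cancel₀ _ h0]
        ring
  refine ⟨fun i => if i = Env.freshIdx σ then s else t i, fun i => ?_, 0, by simp, fun v => ?_⟩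
  · dsimp only
    split_ifs
    · exact hs
    · exact ht i
  have hnoise : ∀ i, (body a b m M σ v).noise i * (if i = Env.freshIdx σ then s else t i)
      = (∑ w, stepMat a b v w * ((σ w).noise i * t i))
        + if i = Env.freshIdx σ then (M - m) / 2 * s * inputVec b v else 0 := by
    intro i
    have h1 : (body a b m M σ v).noise i = _ := congrFun (col_body a b m M σ i) v
    rw [h1]
    split_ifs with h
    · have h0 : ∀ w, (σ w).noise i = 0 := fun w => congrFun (hσ.col_eq_zero h.ge) w
      rw [hσ.col_eq_zero h.ge, Matrix.mulVec_zero]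
      simp [h0]
      ring
    · simp only [Pi.add_apply, zero_smul, Pi.zero_apply, add_zero, Matrix.mulVec, dotProduct,
        Finset.sum_mul, Env.col, mul_assoc]
  have hsw : ∀ w ∈ Finset.univ, Summable fun i => stepMat a b v w * ((σ w).noise i * t i) :=
    fun w _ => ((σ w).summable_noise_mul ht).mul_left _
  have hc : (body a b m M σ v).center = _ := congrFun (center_body a b m M σ) v
  simp_rw [hnoise]
  rw [(summable_sum hsw).tsum_add
    (summable_of_ne_finset_zero (s := {Env.freshIdx σ}) fun i hi => if_neg (by simpa using hi)),
    tsum_ite_eq, Summable.tsum_finsetSum hsw, hc]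
  simp only [tsum_mul_left, Pi.add_apply, Pi.smul_apply, smul_eq_mul, Matrix.mulVec, dotProduct,
    hp, hβ, zero_mul, add_zero, mul_add, Finset.sum_add_distrib, Pi.zero_apply, mul_zero]
  rw [hes]
  ring

end Body

/-! ### Several iterations of the body after a shift -/

section Iterate

variable {n : ℕ} (a : Fin n → ℝ) (b : Fin (n + 1) → ℝ) (m M : ℝ) {σ : Env n}

theorem finiteSupport_iterate (hσ : σ.FiniteSupport) (r : ℕ) :
    Env.FiniteSupport ((body a b m M)^[r] σ.shift) := by
  induction r with
  | zero => exact hσ.shift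
  | succ r ih =>
    rw [Function.iterate_succ_apply']
    exact finiteSupport_body a b m M ih

theorem beta_iterate (σ : Env n) (r : ℕ) : ∀ v, ((body a b m M)^[r] σ.shift v).beta = 0 := by
  induction r with
  | zero => exact fun _ => rfl
  | succ r ih =>
    rw [Function.iterate_succ_apply']
    exact beta_body a b m M ih

theorem center_iterate (σ : Env n) (r : ℕ) :
    (fun v => ((body a b m M)^[r] σ.shift v).center)
      = (stepMat a b ^ r).mulVec (fun v => (σ v).center)
        + ∑ s ∈ Finset.range r, (stepMat a b ^ s).mulVec (((m + M) / 2) • inputVec b) := by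
  induction r with
  | zero => ext v; simp [Env.shift, AForm.moveU]
  | succ r ih =>
    rw [Function.iterate_succ_apply', center_body, ih, Finset.sum_range_succ', Matrix.mulVec_add,
      Matrix.mulVec_mulVec, ← pow_succ', Matrix.mulVec_sum]
    simp only [Matrix.mulVec_mulVec, ← pow_succ', pow_zero, Matrix.one_mulVec]
    abel

/-- The fresh symbols enter a sum over the columns only through fixed terms, one for each variable
and one for each input, whatever their indices are. -/
theorem tsum_col_iterate (hσ : σ.FiniteSupport) (r : ℕ) {φ : (Var n → ℝ) → ℝ} (hφ : φ 0 = 0) :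
    ∑' i, φ (Env.col ((body a b m M)^[r] σ.shift) i)
      = ∑' i, φ ((stepMat a b ^ r).mulVec (σ.col i))
        + ∑ w, φ ((stepMat a b ^ r).mulVec (Pi.single w (σ w).beta))
        + ∑ s ∈ Finset.range r,
            φ ((stepMat a b ^ s).mulVec (((M - m) / 2) • inputVec b)) := by
  induction r generalizing φ with
  | zero =>
    simp only [Function.iterate_zero, id_eq, pow_zero, Matrix.one_mulVec, Finset.range_zero,
      Finset.sum_empty, add_zero]
    exact Env.tsum_col_shift hσ hφ
  | succ r ih =>
    rw [Function.iterate_succ_apply', tsum_col_body a b m M (finiteSupport_iterate a b m M hσ r) hφ,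
      ih (φ := fun p => φ ((stepMat a b).mulVec p)) (by rw [Matrix.mulVec_zero, hφ]),
      Finset.sum_range_succ']
    simp only [Matrix.mulVec_mulVec, ← pow_succ', pow_zero, Matrix.one_mulVec]
    ring

/-- The symbols of `σ` are not used again for the new inputs: the first unused index grows with each
iteration, except for constant inputs, whose symbol has coefficient `0`. -/
theorem col_iterate (hn : 1 ≤ n) (hσ : σ.FiniteSupport) (r : ℕ) {i : ℕ}
    (hi : i < Env.freshIdx σ) :
    Env.col ((body a b m M)^[r] σ.shift) i = (stepMat a b ^ r).mulVec (σ.col i) := by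
  have hfresh : m ≠ M → ∀ r, i < Env.freshIdx ((body a b m M)^[r] σ.shift) := by
    intro hmM r
    induction r with
    | zero => exact hi.trans_le (Env.freshIdx_le_shift hσ)
    | succ r ih =>
      rw [Function.iterate_succ_apply']
      exact ih.trans (freshIdx_lt_body a b m M hn hmM (finiteSupport_iterate a b m M hσ r))
  induction r with
  | zero => simpa using σ.col_shift_of_lt hi
  | succ r ih =>
    rw [Function.iterate_succ_apply', col_body, ih, Matrix.mulVec_mulVec, ← pow_succ']
    rcases eq_or_ne m M with h | h
    · simp [h]
    · rw [if_neg (hfresh h r).ne, zero_smul, add_zero]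

end Iterate

section Widening

variable {n : ℕ} (a : Fin n → ℝ) (b : Fin (n + 1) → ℝ) (m M : ℝ) {σ : Env n}

theorem dev_iterate (hσ : σ.FiniteSupport) (q : ℕ) (v : Var n) :
    ((body a b m M)^[q] σ.shift v).dev
      = ∑' i, |(stepMat a b ^ q).mulVec (σ.col i) v|
        + ∑ w, |(stepMat a b ^ q) v w| * (σ w).beta
        + ∑ s ∈ Finset.range q, |(stepMat a b ^ s).mulVec (((M - m) / 2) • inputVec b) v| := by
  have h := tsum_col_iterate a b m M hσ q (φ := fun p => |p v|) (by simp)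
  rw [AForm.dev, beta_iterate, add_zero]
  refine h.trans ?_
  congr 2
  refine Finset.sum_congr rfl fun w _ => ?_
  simp [abs_mul, mul_comm, abs_of_nonneg (σ w).beta_nonneg]

/-- One step of the iteration acts on each symbol separately. For a symbol that does not occur in
`σ` both sides vanish, whatever its coefficient after the iterations is. -/
theorem noise_nabla_iterate (hn : 1 ≤ n) (hσ : σ.FiniteSupport) (q : ℕ) (v : Var n) (i : ℕ) :
    (σ.nabla ((body a b m M)^[q] σ.shift) v).noise i
      = AForm.argmin (σ.col i v) ((stepMat a b ^ q).mulVec (σ.col i) v) := by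
  change AForm.argmin (σ.col i v) (Env.col ((body a b m M)^[q] σ.shift) i v) = _
  rcases lt_or_ge i (Env.freshIdx σ) with h | h
  · rw [col_iterate a b m M hn hσ q h]
  · have h0 : ∀ x, AForm.argmin 0 x = 0 := fun x => by
      unfold AForm.argmin
      grind
    rw [hσ.col_eq_zero h, Pi.zero_apply, h0, h0]

/-! ### Boundedness of the iterates -/

theorem AForm.abs_center_add_dev_le_iff (x : AForm) (W : ℝ) :
    |x.center| + x.dev ≤ W ↔ -W ≤ x.lo ∧ x.hi ≤ W := by
  rw [← le_sub_iff_add_le, abs_le, AForm.lo, AForm.hi]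
  constructor <;> rintro ⟨h1, h2⟩ <;> constructor <;> linarith

/-- The magnitude of the perturbation by the inputs read during `q` iterations. -/
noncomputable def inputMag (q : ℕ) (v : Var n) : ℝ :=
  |(∑ s ∈ Finset.range q, (stepMat a b ^ s).mulVec (((m + M) / 2) • inputVec b)) v|
    + ∑ s ∈ Finset.range q, |(stepMat a b ^ s).mulVec (((M - m) / 2) • inputVec b) v|

theorem abs_center_add_dev_iterate_le (hσ : σ.FiniteSupport) (q : ℕ) (v : Var n) :
    |((body a b m M)^[q] σ.shift v).center| + ((body a b m M)^[q] σ.shift v).dev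
      ≤ ∑ w, |(stepMat a b ^ q) v w| * (|(σ w).center| + (σ w).dev) + inputMag a b m M q v := by
  have hc := congrFun (center_iterate a b m M σ q) v
  simp only [Pi.add_apply] at hc
  have h1 := abs_mulVec_le (stepMat a b ^ q) (fun w => (σ w).center) v
  have hs : ∀ w ∈ Finset.univ, Summable fun i => |(stepMat a b ^ q) v w| * |(σ w).noise i| :=
    fun w _ => (σ w).summable.mul_left _
  have hle : ∀ i, |(stepMat a b ^ q).mulVec (σ.col i) v|
      ≤ ∑ w, |(stepMat a b ^ q) v w| * |(σ w).noise i| := fun i =>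
    abs_mulVec_le _ _ _
  have h2 : ∑' i, |(stepMat a b ^ q).mulVec (σ.col i) v|
      ≤ ∑ w, |(stepMat a b ^ q) v w| * (σ w).normL := by
    refine (Summable.tsum_le_tsum hle ((summable_sum hs).of_nonneg_of_le
      (fun _ => abs_nonneg _) hle) (summable_sum hs)).trans_eq ?_
    rw [Summable.tsum_finsetSum hs]
    exact Finset.sum_congr rfl fun w _ => tsum_mul_left
  rw [hc, dev_iterate a b m M hσ, inputMag]
  have h3 := abs_add_le ((stepMat a b ^ q).mulVec (fun v => (σ v).center) v)
    ((∑ s ∈ Finset.range q, (stepMat a b ^ s).mulVec (((m + M) / 2) • inputVec b)) v)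
  simp only [AForm.dev, mul_add, Finset.sum_add_distrib]
  linarith

/-- A box that is invariant under the iteration. It exists because the matrix of absolute values of
the `q`-th power of `stepMat` has the contraction `|C ^ q|` as its only nonzero diagonal block. -/
theorem exists_invariant_box {q : ℕ} (hq : n ≤ q)
    (hrow : ∀ i, ∑ j, |(companion a ^ q) i j| ≤ 1 / 2) (μ K : Var n → ℝ) :
    ∃ W : Var n → ℝ, (∀ v, μ v ≤ W v) ∧
      ∀ v, ∑ w, |(stepMat a b ^ q) v w| * W w + K v ≤ W v := by
  let U : Fin n → ℝ := fun j => max (μ (Sum.inr j)) (K (Sum.inr j))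
  let B : Fin n → ℝ := fun i =>
    ∑ j, |(stepMat a b ^ q) (Sum.inl i) (Sum.inr j)| * U j + K (Sum.inl i)
  -- half of the bound on the outputs pays for the contraction, the other half for `B`
  let w : ℝ := ∑ i, |μ (Sum.inl i)| + 2 * ∑ i, |B i|
  have hμw : ∀ i, |μ (Sum.inl i)| ≤ ∑ i, |μ (Sum.inl i)| := fun i =>
    Finset.single_le_sum (f := fun i => |μ (Sum.inl i)|) (fun _ _ => abs_nonneg _)
      (Finset.mem_univ i)
  have hBw : ∀ i, |B i| ≤ ∑ i, |B i| := fun i =>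
    Finset.single_le_sum (f := fun i => |B i|) (fun _ _ => abs_nonneg _) (Finset.mem_univ i)
  have hw0 : 0 ≤ w := by positivity
  refine ⟨Sum.elim (fun _ => w) U, ?_, ?_⟩
  · rintro (i | j)
    · have := le_abs_self (μ (Sum.inl i))
      have := hμw i
      have := (abs_nonneg _).trans (hBw i)
      simp only [Sum.elim_inl, w]
      linarith
    · exact le_max_left _ _
  · rintro (i | j)
    · rw [Fintype.sum_sum_type]
      simp only [Sum.elim_inl, Sum.elim_inr, stepMat_pow_inl_inl, ← Finset.sum_mul]
      have h1 := mul_le_mul_of_nonneg_right (hrow i) hw0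
      have h2 : B i ≤ w / 2 := by
        have := le_abs_self (B i)
        have := hBw i
        have := (abs_nonneg _).trans (hμw i)
        simp only [w]
        linarith
      simp only [B] at h2
      linarith
    · simp only [stepMat_pow_inr a b hq, abs_zero, zero_mul, Finset.sum_const_zero, zero_add]
      exact le_max_right _ _

/-- The iterates `σ ↦ σ ∇ F^q (!σ)`, without the replacement by `⊤`. -/
noncomputable def widenSeq (q : ℕ) (σ₀ : Env n) : ℕ → Env n
  | 0 => σ₀
  | k + 1 => (widenSeq q σ₀ k).nabla ((body a b m M)^[q] (widenSeq q σ₀ k).shift)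

theorem widenSeq_below_succ (q : ℕ) (σ₀ : Env n) (k : ℕ) (v : Var n) :
    (widenSeq a b m M q σ₀ k v).Below (widenSeq a b m M q σ₀ (k + 1) v) :=
  AForm.below_nabla_left _ _

/-- No new noise symbol survives the widening, so that the support never grows. -/
theorem widenSeq_noise_eq_zero (q : ℕ) {σ₀ : Env n} {N : ℕ}
    (hN : ∀ v i, N ≤ i → (σ₀ v).noise i = 0) (k : ℕ) :
    ∀ v i, N ≤ i → (widenSeq a b m M q σ₀ k v).noise i = 0 := by
  induction k with
  | zero => exact hN
  | succ k ih =>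
    intro v i hi
    have h := (widenSeq_below_succ a b m M q σ₀ k v).noise_le i
    rw [ih v i hi, abs_zero] at h
    have h1 := abs_nonneg (0 - (widenSeq a b m M q σ₀ (k + 1) v).noise i)
    exact abs_nonpos_iff.1 (by linarith)

theorem widenSeq_bounded {q : ℕ} (hq : n ≤ q)
    (hrow : ∀ i, ∑ j, |(companion a ^ q) i j| ≤ 1 / 2) {σ₀ : Env n} (hσ₀ : σ₀.FiniteSupport) :
    ∃ W : Var n → ℝ, ∀ k v, -W v ≤ (widenSeq a b m M q σ₀ k v).lo ∧
      (widenSeq a b m M q σ₀ k v).hi ≤ W v := by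
  obtain ⟨W, hW0, hW⟩ := exists_invariant_box a b hq hrow (fun v => |(σ₀ v).center| + (σ₀ v).dev)
    (inputMag a b m M q)
  obtain ⟨N, hN⟩ := hσ₀
  refine ⟨W, fun k => ?_⟩
  induction k with
  | zero => exact fun v => (AForm.abs_center_add_dev_le_iff _ _).1 (hW0 v)
  | succ k ih =>
    intro v
    have h := abs_center_add_dev_iterate_le a b m M
      ⟨N, widenSeq_noise_eq_zero a b m M q hN k⟩ q v
    have h2 : ∑ w, |(stepMat a b ^ q) v w| * (|(widenSeq a b m M q σ₀ k w).center|
        + (widenSeq a b m M q σ₀ k w).dev) ≤ ∑ w, |(stepMat a b ^ q) v w| * W w :=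
      Finset.sum_le_sum fun w _ => mul_le_mul_of_nonneg_left
        ((AForm.abs_center_add_dev_le_iff _ _).2 (ih w)) (abs_nonneg _)
    have h3 := (AForm.abs_center_add_dev_le_iff _ (W v)).1 (by linarith [hW v])
    rw [widenSeq, Env.nabla, AForm.lo_nabla, AForm.hi_nabla]
    exact ⟨le_min (ih v).1 h3.1, max_le (ih v).2 h3.2⟩

end Widening

/-! ### Limits of affine forms -/

/-- Convergence of affine forms over the first `N` noise symbols, in terms of the bounds of the
concretizations and of the noise coefficients. -/
structure AForm.TendsTo (N : ℕ) (x : ℕ → AForm) (y : AForm) : Prop where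
  support : ∀ k i, N ≤ i → (x k).noise i = 0
  support_lim : ∀ i, N ≤ i → y.noise i = 0
  lo : Tendsto (fun k => (x k).lo) atTop (𝓝 y.lo)
  hi : Tendsto (fun k => (x k).hi) atTop (𝓝 y.hi)
  noise : ∀ i, Tendsto (fun k => (x k).noise i) atTop (𝓝 (y.noise i))

namespace AForm

theorem normL_eq_sum_range {x : AForm} {N : ℕ} (hN : ∀ i, N ≤ i → x.noise i = 0) :
    x.normL = ∑ i ∈ Finset.range N, |x.noise i| :=
  tsum_eq_sum fun i hi => by rw [hN i (by simpa using hi), abs_zero]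

/-- A sequence that moves towards `0` without crossing it converges, since its positive and its
negative part decrease. -/
theorem exists_tendsto_of_abs_sub_add_le {u : ℕ → ℝ}
    (hu : ∀ k, |u k - u (k + 1)| + |u (k + 1)| ≤ |u k|) : ∃ l, Tendsto u atTop (𝓝 l) := by
  have h1 : Antitone fun k => max (u k) 0 := antitone_nat_of_succ_le fun k => by
    have := hu k
    grind
  have h2 : Antitone fun k => max (-u k) 0 := antitone_nat_of_succ_le fun k => by
    have := hu k
    grind
  have h := (tendsto_atTop_ciInf h1 ⟨0, by rintro _ ⟨k, rfl⟩; exact le_max_right _ _⟩).sub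
    (tendsto_atTop_ciInf h2 ⟨0, by rintro _ ⟨k, rfl⟩; exact le_max_right _ _⟩)
  exact ⟨_, h.congr fun k => by grind⟩

theorem exists_tendsTo {x : ℕ → AForm} {N : ℕ} (hN : ∀ k i, N ≤ i → (x k).noise i = 0)
    (hx : ∀ k, (x k).Below (x (k + 1))) {W : ℝ} (hW : ∀ k, -W ≤ (x k).lo ∧ (x k).hi ≤ W) :
    ∃ y, TendsTo N x y := by
  have hlo : Antitone fun k => (x k).lo := antitone_nat_of_succ_le fun k => (hx k).lo_le
  have hhi : Monotone fun k => (x k).hi := monotone_nat_of_le_succ fun k => (hx k).hi_le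
  have hl := tendsto_atTop_ciInf hlo ⟨-W, by rintro _ ⟨k, rfl⟩; exact (hW k).1⟩
  have hh := tendsto_atTop_ciSup hhi ⟨W, by rintro _ ⟨k, rfl⟩; exact (hW k).2⟩
  choose α hα using fun i => exists_tendsto_of_abs_sub_add_le fun k => (hx k).noise_le i
  have hα0 : ∀ i, N ≤ i → α i = 0 := fun i hi =>
    tendsto_nhds_unique (hα i) (by simp only [hN _ i hi]; exact tendsto_const_nhds)
  set l := ⨅ k, (x k).lo
  set h := ⨆ k, (x k).hi
  have hsum : Summable fun i => |α i| :=
    summable_of_ne_finset_zero (s := Finset.range N) fun i hi => by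
      rw [hα0 i (by simpa using hi), abs_zero]
  have hL : ∑' i, |α i| = ∑ i ∈ Finset.range N, |α i| :=
    tsum_eq_sum fun i hi => by rw [hα0 i (by simpa using hi), abs_zero]
  have hβ : 0 ≤ (h - l) / 2 - ∑' i, |α i| := by
    have ht : Tendsto (fun k => ((x k).hi - (x k).lo) / 2
        - ∑ i ∈ Finset.range N, |(x k).noise i|) atTop
        (𝓝 ((h - l) / 2 - ∑ i ∈ Finset.range N, |α i|)) :=
      ((hh.sub hl).div_const 2).sub (tendsto_finsetSum _ fun i _ => (hα i).abs)
    rw [hL]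
    refine ge_of_tendsto' ht fun k => ?_
    have := (x k).beta_nonneg
    rw [← normL_eq_sum_range (hN k), AForm.hi, AForm.lo, dev]
    linarith
  let y : AForm := ⟨(l + h) / 2, α, (h - l) / 2 - ∑' i, |α i|, hsum, hβ⟩
  have hylo : y.lo = l := by
    simp only [AForm.lo, dev, normL, y]
    ring
  have hyhi : y.hi = h := by
    simp only [AForm.hi, dev, normL, y]
    ring
  exact ⟨y, hN, hα0, by rwa [hylo], by rwa [hyhi], hα⟩

namespace TendsTo

variable {N : ℕ} {x : ℕ → AForm} {y : AForm}

theorem center (h : TendsTo N x y) : Tendsto (fun k => (x k).center) atTop (𝓝 y.center) := by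
  have hc : ∀ z : AForm, (z.lo + z.hi) / 2 = z.center := fun z => by
    rw [AForm.lo, AForm.hi]
    ring
  simpa only [hc] using (h.lo.add h.hi).div_const 2

theorem beta (h : TendsTo N x y) : Tendsto (fun k => (x k).beta) atTop (𝓝 y.beta) := by
  have hc : ∀ z : AForm, (∀ i, N ≤ i → z.noise i = 0) →
      (z.hi - z.lo) / 2 - ∑ i ∈ Finset.range N, |z.noise i| = z.beta := fun z hz => by
    rw [← normL_eq_sum_range hz, AForm.lo, AForm.hi, dev]
    ring
  rw [← hc y h.support_lim]
  simp_rw [← fun k => hc (x k) (h.support k)]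
  exact ((h.hi.sub h.lo).div_const 2).sub (tendsto_finsetSum _ fun i _ => (h.noise i).abs)

theorem l1dist (h : TendsTo N x y) : Tendsto (fun k => (x k).l1dist y) atTop (𝓝 0) := by
  have hc : ∀ k, (x k).l1dist y = |(x k).center - y.center|
      + ∑ i ∈ Finset.range N, |(x k).noise i - y.noise i| + |(x k).beta - y.beta| := fun k => by
    rw [AForm.l1dist, tsum_eq_sum (s := Finset.range N)]
    intro i hi
    rw [h.support k i (by simpa using hi), h.support_lim i (by simpa using hi), sub_zero, abs_zero]
  simp_rw [hc]
  have ht := (((h.center.sub_const y.center).abs.add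
    (tendsto_finsetSum (Finset.range N) fun i _ => ((h.noise i).sub_const (y.noise i)).abs)).add
    (h.beta.sub_const y.beta).abs)
  simpa using ht

theorem below (h : TendsTo N x y) (hx : ∀ k, (x k).Below (x (k + 1))) (k : ℕ) :
    (x k).Below y := by
  have hle : ∀ j, k ≤ j → (x k).Below (x j) := fun j hj => by
    induction j, hj using Nat.le_induction with
    | base => exact Below.refl _
    | succ j _ ih => exact ih.trans (hx j)
  have hev := eventually_ge_atTop (α := ℕ) k
  exact ⟨le_of_tendsto h.lo (hev.mono fun j hj => (hle j hj).lo_le),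
    ge_of_tendsto h.hi (hev.mono fun j hj => (hle j hj).hi_le),
    fun i => le_of_tendsto (((h.noise i).const_sub _).abs.add (h.noise i).abs)
      (hev.mono fun j hj => (hle j hj).noise_le i)⟩

end TendsTo

end AForm

section Limit

variable {n : ℕ} (a : Fin n → ℝ) (b : Fin (n + 1) → ℝ) (m M : ℝ)

/-- The concretizations of `F^q (!σ)` depend continuously on `σ`, although the fresh symbols do
not. -/
theorem tendsto_lo_hi_iterate (q : ℕ) {N : ℕ} {s : ℕ → Env n} {σ : Env n}
    (h : ∀ v, AForm.TendsTo N (fun k => s k v) (σ v)) (v : Var n) :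
    Tendsto (fun k => ((body a b m M)^[q] (s k).shift v).lo) atTop
        (𝓝 ((body a b m M)^[q] σ.shift v).lo) ∧
      Tendsto (fun k => ((body a b m M)^[q] (s k).shift v).hi) atTop
        (𝓝 ((body a b m M)^[q] σ.shift v).hi) := by
  have hc : Tendsto (fun k => ((body a b m M)^[q] (s k).shift v).center) atTop
      (𝓝 ((body a b m M)^[q] σ.shift v).center) := by
    have he : ∀ τ : Env n, ((body a b m M)^[q] τ.shift v).center = _ := fun τ =>
      congrFun (center_iterate a b m M τ q) v
    simp_rw [he, Pi.add_apply]
    exact (tendsto_mulVec _ (fun w => (h w).center) v).add_const _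
  have hd : Tendsto (fun k => ((body a b m M)^[q] (s k).shift v).dev) atTop
      (𝓝 ((body a b m M)^[q] σ.shift v).dev) := by
    have he : ∀ τ : Env n, (∀ w i, N ≤ i → (τ w).noise i = 0) →
        ((body a b m M)^[q] τ.shift v).dev
          = ∑ i ∈ Finset.range N, |(stepMat a b ^ q).mulVec (τ.col i) v|
            + ∑ w, |(stepMat a b ^ q) v w| * (τ w).beta
            + ∑ s ∈ Finset.range q,
              |(stepMat a b ^ s).mulVec (((M - m) / 2) • inputVec b) v| := fun τ hτ => by
      rw [dev_iterate a b m M ⟨N, hτ⟩, tsum_eq_sum (s := Finset.range N)]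
      intro i hi
      have h0 : τ.col i = 0 := funext fun w => hτ w i (by simpa using hi)
      rw [h0, Matrix.mulVec_zero, Pi.zero_apply, abs_zero]
    rw [he σ fun w => (h w).support_lim]
    simp_rw [fun k => he (s k) fun w => (h w).support k]
    exact ((tendsto_finsetSum _ fun i _ => (tendsto_mulVec _ (fun w => (h w).noise i) v).abs).add
      (tendsto_finsetSum _ fun w _ => (h w).beta.const_mul _)).add_const _
  exact ⟨hc.sub hd, hc.add hd⟩

/-- A limit of the iteration is a fixed point, since the bounds and the coefficients of
`σ ∇ F^q (!σ)` depend continuously on `σ`. -/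
theorem nabla_iterate_eq_of_tendsTo (hn : 1 ≤ n) (q : ℕ) {N : ℕ} {s : ℕ → Env n} {σ : Env n}
    (hs : ∀ k, s (k + 1) = (s k).nabla ((body a b m M)^[q] (s k).shift))
    (h : ∀ v, AForm.TendsTo N (fun k => s k v) (σ v)) :
    σ.nabla ((body a b m M)^[q] σ.shift) = σ := by
  ext1 v
  obtain ⟨hlo, hhi⟩ := tendsto_lo_hi_iterate a b m M q h v
  have hσ : σ.FiniteSupport := ⟨N, fun w => (h w).support_lim⟩
  have hsupp : ∀ k, (s k).FiniteSupport := fun k => ⟨N, fun w => (h w).support k⟩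
  refine AForm.ext_of_lo_hi ?_ ?_ (funext fun i => ?_)
  · refine tendsto_nhds_unique ?_ ((h v).lo.comp (tendsto_add_atTop_nat 1))
    simp only [Function.comp_def, hs, Env.nabla, AForm.lo_nabla]
    exact (h v).lo.min hlo
  · refine tendsto_nhds_unique ?_ ((h v).hi.comp (tendsto_add_atTop_nat 1))
    simp only [Function.comp_def, hs, Env.nabla, AForm.hi_nabla]
    exact (h v).hi.max hhi
  · refine tendsto_nhds_unique ?_ (((h v).noise i).comp (tendsto_add_atTop_nat 1))
    rw [noise_nabla_iterate a b m M hn hσ]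
    simp only [Function.comp_def, hs, noise_nabla_iterate a b m M hn (hsupp _)]
    have h1 : Tendsto (fun k => (s k).col i v) atTop (𝓝 (σ.col i v)) := (h v).noise i
    have h2 : Tendsto (fun k => (stepMat a b ^ q).mulVec ((s k).col i) v) atTop
        (𝓝 ((stepMat a b ^ q).mulVec (σ.col i) v)) :=
      tendsto_mulVec _ (fun w => (h w).noise i) v
    exact (h1.min h2).max ((h1.max h2).min tendsto_const_nhds)

theorem scheme_eq_val_widenSeq (q : ℕ) (σ₀ : Env n) {lo hi : ℝ}
    (h : ∀ k v, (widenSeq a b m M q σ₀ k v).gamma ⊆ Set.Icc lo hi) (k : ℕ) :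
    scheme σ₀ (body a b m M) q lo hi (k + 1) = Lifted.val (widenSeq a b m M q σ₀ k) := by
  induction k with
  | zero => exact if_pos (h 0)
  | succ k ih =>
    rw [scheme, ih]
    exact if_pos (h (k + 1))

/-! ### Runs of the filter -/

theorem stateAt_succ {x e : ℕ → ℝ} {k : ℕ}
    (h : x (k + n) = ∑ i : Fin n, a i * x (k + i) + ∑ j : Fin (n + 1), b j * e (k + j)) :
    stateAt n x e (k + 1)
      = (stepMat a b).mulVec (stateAt n x e k) + e (k + n) • inputVec b := by
  ext (i | i)
  · simp only [Pi.add_apply, stepMat_mulVec_inl, stateAt, Sum.elim_inl, Sum.elim_inr, inputVec,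
      Pi.smul_apply, smul_eq_mul]
    split_ifs with hi
    · rw [mul_zero, add_zero, add_right_comm, add_assoc]
    · rw [show k + 1 + (i : ℕ) = k + n by omega, h, Fin.sum_univ_castSucc]
      simp only [Fin.val_castSucc, Fin.val_last]
      ring
  · simp only [Pi.add_apply, stepMat_mulVec_inr, stateAt, Sum.elim_inr, inputVec,
      Pi.smul_apply, smul_eq_mul]
    split_ifs with hi
    · rw [mul_zero, add_zero, add_right_comm, add_assoc]
    · rw [show k + 1 + (i : ℕ) = k + n by omega, zero_add, mul_one]

theorem stateAt_add_mem_gamma_iterate {σ : Env n} (hσ : σ.FiniteSupport) {x e : ℕ → ℝ}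
    (he : ∀ k, e (k + n) ∈ Set.Icc m M)
    (hx : ∀ k, x (k + n) = ∑ i : Fin n, a i * x (k + i) + ∑ j : Fin (n + 1), b j * e (k + j))
    {k : ℕ} (hk : stateAt n x e k ∈ σ.gamma) (r : ℕ) :
    stateAt n x e (k + r) ∈ Env.gamma ((body a b m M)^[r] σ.shift) := by
  induction r with
  | zero => exact Env.gamma_subset_gamma_shift hσ hk
  | succ r ih =>
    rw [Function.iterate_succ_apply', ← add_assoc, stateAt_succ a b (hx _)]
    exact mem_gamma_body a b m M (finiteSupport_iterate a b m M hσ r) (beta_iterate a b m M σ r)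
      ih (he _)

theorem gamma_iterate_subset_gamma_copiesJoin (F : Env n → Env n) (σ : Env n) {r q : ℕ}
    (hr : r < q) : Env.gamma (F^[r] σ.shift) ⊆ Env.gamma (copiesJoin F σ q) := by
  induction q, hr using Nat.le_induction with
  | base => exact Env.gamma_mono fun v => AForm.below_nabla_right _ _
  | succ q _ ih => exact ih.trans (Env.gamma_mono fun v => AForm.below_nabla_left _ _)

end Limit

end AffineFilter

open AffineFilter

theorem mainTheorem1 (n : ℕ) (hn : 1 ≤ n) (a : Fin n → ℝ)
    (hstable : ∀ z : ℂ, z ^ n - ∑ i : Fin n, (a i : ℂ) * z ^ (i : ℕ) = 0 → ‖z‖ < 1) :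
    ∃ q : ℕ, 1 ≤ q ∧
      ∀ (b : Fin (n + 1) → ℝ) (m M : ℝ), m ≤ M →
      ∀ σ₀ : Env n, σ₀.FiniteSupport →
      ∃ σ : Env n, σ.FiniteSupport ∧
        (∀ lo hi : ℝ, (∀ v, (σ v).gamma ⊆ Set.Icc lo hi) →
          ConvergesTo (scheme σ₀ (body a b m M) q lo hi) σ) ∧
        σ.nabla ((body a b m M)^[q] σ.shift) = σ ∧
        ∀ x e : ℕ → ℝ, IsRun a b m M σ₀ x e →
          (∀ t, stateAt n x e (t * q) ∈ σ.gamma) ∧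
          (∀ t r, r < q →
            stateAt n x e (t * q + r) ∈ Env.gamma ((body a b m M)^[r] σ.shift)) ∧
          (∀ k, stateAt n x e k ∈ Env.gamma (copiesJoin (body a b m M) σ q)) ∧
          ∀ (k : ℕ) (i : Fin n),
            x (k + i) ∈ (copiesJoin (body a b m M) σ q (Sum.inl i)).gamma := by
  obtain ⟨q, hq, hrow⟩ := exists_companion_pow_rowSum_le hn a hstable
  have hq1 : 1 ≤ q := hn.trans hq
  refine ⟨q, hq1, fun b m M _ σ₀ hσ₀ => ?_⟩
  obtain ⟨W, hW⟩ := widenSeq_bounded a b m M hq hrow hσ₀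
  obtain ⟨N, hN⟩ := hσ₀
  have hbelow := widenSeq_below_succ a b m M q σ₀
  choose σ hlim using fun v => AForm.exists_tendsTo
    (fun k => widenSeq_noise_eq_zero a b m M q hN k v) (fun k => hbelow k v) (fun k => hW k v)
  have hle : ∀ k v, (widenSeq a b m M q σ₀ k v).Below (σ v) := fun k v =>
    (hlim v).below (fun k => hbelow k v) k
  have hσ : Env.FiniteSupport σ := ⟨N, fun v => (hlim v).support_lim⟩
  have hfix : Env.nabla σ ((body a b m M)^[q] (Env.shift σ)) = σ :=
    nabla_iterate_eq_of_tendsTo a b m M hn q (fun _ => rfl) hlim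
  refine ⟨σ, hσ, fun lo hi hI => ?_, hfix, fun x e hrun => ?_⟩
  · refine ⟨widenSeq a b m M q σ₀, scheme_eq_val_widenSeq a b m M q σ₀ fun k v => ?_,
      fun v => (hlim v).l1dist⟩
    exact (Set.Icc_subset_Icc (hle k v).lo_le (hle k v).hi_le).trans (hI v)
  · obtain ⟨h0, he, hx⟩ := hrun
    have hhead : ∀ t, stateAt n x e (t * q) ∈ Env.gamma σ := by
      intro t
      induction t with
      | zero =>
        rw [zero_mul]
        exact Env.gamma_mono (hle 0) h0
      | succ t ih =>
        rw [add_mul, one_mul, ← hfix]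
        exact Env.gamma_mono (fun v => AForm.below_nabla_right _ _)
          (stateAt_add_mem_gamma_iterate a b m M hσ he hx ih q)
    have hcopy : ∀ t r, r < q →
        stateAt n x e (t * q + r) ∈ Env.gamma ((body a b m M)^[r] (Env.shift σ)) :=
      fun t r _ => stateAt_add_mem_gamma_iterate a b m M hσ he hx (hhead t) r
    have hjoin : ∀ k, stateAt n x e k ∈ Env.gamma (copiesJoin (body a b m M) σ q) := by
      intro k
      have hr : k % q < q := Nat.mod_lt _ hq1
      have h := gamma_iterate_subset_gamma_copiesJoin (body a b m M) σ hr (hcopy (k / q) _ hr)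
      rwa [mul_comm, Nat.div_add_mod] at h
    exact ⟨hhead, hcopy, hjoin, fun k i => Env.mem_gamma_apply (hjoin k) (Sum.inl i)⟩
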